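/- Let $0\le n\le m$ and let $f\in\mathbb{R}[x_1,\dots,x_m]$ be real stable, i.e. $f(z)\neq 0$ for all $z\in\mathbb{C}^m$ with $\operatorname{Im} z_i>0$ for $i=1,\dots,m$. Suppose that there are complex $n\times n$ matrices $A_0,A_{n+1},\dots,A_m$ such that \[ f=\det\Big(\operatorname{diag}(x_1,\dots,x_n)+\sum_{j=n+1}^m A_j x_j+A_0\Big). \] Then there are Hermitian $n\times n$ matrices $B_0,B_{n+1},\dots,B_m$ such that \[ f=\det\Big(\operatorname{diag}(x_1,\dots,x_n)+\sum_{j=n+1}^m B_j x_j+B_0\Big). \] (This is a definite Hermitian determinantal representation of $f$: the linear part $\operatorname{diag}(x_1,\dots,x_n)+\sum_{j=n+1}^m B_jx_j$ is the identity matrix at $x=(1,\dots,1,0,\dots,0)$, where the first $n$ coordinates are $1$.) -/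

import Mathlib

/-- A real polynomial is (real) stable if it has no zero all of whose coordinates lie in the
open upper half-plane. -/
def RealStable {σ : Type*} (f : MvPolynomial σ ℝ) : Prop :=
  ∀ z : σ → ℂ, (∀ i, 0 < (z i).im) → MvPolynomial.aeval z f ≠ 0

/-- The affine linear matrix pencil
`diag(x₁, …, xₙ) + ∑ j, A j * x_{n+j} + A₀` with entries in `ℂ[x₁, …, xₙ, x_{n+1}, …, x_{n+k}]`.
The variables `x₁, …, xₙ` are indexed by `Sum.inl`, the others by `Sum.inr`. -/
noncomputable def detPencil {n k : ℕ} (A₀ : Matrix (Fin n) (Fin n) ℂ)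
    (A : Fin k → Matrix (Fin n) (Fin n) ℂ) :
    Matrix (Fin n) (Fin n) (MvPolynomial (Fin n ⊕ Fin k) ℂ) :=
  Matrix.diagonal (fun i => MvPolynomial.X (Sum.inl i))
    + ∑ j, (MvPolynomial.X (Sum.inr j) : MvPolynomial (Fin n ⊕ Fin k) ℂ) •
        (A j).map MvPolynomial.C
    + A₀.map MvPolynomial.C

/-! Let `M` be the pencil at a real point and `N = M⁻¹`. Stability forces `N i j * N j i ≥ 0`
(`inv_mul_inv_nonneg`), so wherever `N i j` and `N j i` are nonzero, `N j i` is a positive multiple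
`l i j` of `conj (N i j)`. Moving `x_l` changes `N` by a rank one term; since nonnegativity persists
along that line, the multipliers satisfy a cocycle identity (`inv_pencilAt_cocycle`).

The nonzero entries of the adjugate of the pencil form a preorder (`adjugate_detPencil_trans`).
Inside one of its equivalence classes the cocycle is a coboundary `l i j = d j / d i`, so with `D =
diag(d)` the class block of `N`, hence that of `M`, satisfies `M D = D Mᴴ`
(`exists_pos_symmetrizer`).

A priori `d` depends on the point, but `M i j * M j i ≥ 0` within classes does not mention `d`.
Along a line in a nondiagonal variable this inequality ties the slopes `A l` to the values at the
base point (`conj_of_mul_nonneg`), so one `d` serves the whole pencil. Deleting the entries between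
classes preserves the determinant, and conjugation by `D^(1/2)` makes what is left Hermitian. -/

open scoped ComplexOrder ComplexConjugate
open Matrix

/-! ### Nonnegativity on the real line -/

/-- If a product of two affine functions is nonnegative on the real line, they are conjugate up to a
positive factor. -/
theorem conj_of_mul_nonneg {u v a b : ℂ} (hu : u ≠ 0) (hv : v ≠ 0)
    (h : ∀ t : ℝ, 0 ≤ (u + t * a) * (v + t * b)) : b * conj u = conj a * v := by
  have h0 := h 0
  simp only [Complex.ofReal_zero, zero_mul, add_zero] at h0
  obtain ⟨r, hr⟩ : ∃ r : ℝ, v = r * conj u := by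
    refine ⟨(u * v).re / Complex.normSq u, ?_⟩
    have h1 : ((u * v).re : ℂ) = u * v := by
      apply Complex.ext <;> simp [← (Complex.nonneg_iff.1 h0).2]
    have h2 : (Complex.normSq u : ℂ) ≠ 0 := by simpa using hu
    have h3 : (Complex.normSq u : ℂ) = u * conj u := (Complex.mul_conj u).symm
    rw [Complex.ofReal_div, h1, h3]
    have : conj u ≠ 0 := by simpa using hu
    field_simp
  have hr0 : 0 < r := by
    subst hr
    have h1 : u * (r * conj u) = ((r * Complex.normSq u : ℝ) : ℂ) := by
      rw [mul_left_comm, Complex.mul_conj]; push_cast; ring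
    rw [h1, Complex.zero_le_real] at h0
    have h2 : 0 < Complex.normSq u := Complex.normSq_pos.2 hu
    have h3 : r ≠ 0 := by rintro rfl; simp at hv
    exact lt_of_le_of_ne (nonneg_of_mul_nonneg_left h0 h2) h3.symm
  set w : ℂ := a / u with hw
  set z : ℂ := b / v with hz
  have key : ∀ t : ℝ, 0 ≤ (1 + t * w) * (1 + t * z) := by
    intro t
    have h1 : (u + t * a) * (v + t * b) = (r * Complex.normSq u : ℝ) * ((1 + t * w) * (1 + t * z)) := by
      have h2 : (Complex.normSq u : ℂ) = u * conj u := (Complex.mul_conj u).symm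
      have : u + t * a = u * (1 + t * w) := by rw [hw]; field_simp
      rw [this]
      have : v + t * b = v * (1 + t * z) := by rw [hz]; field_simp
      rw [this]
      push_cast
      rw [h2]
      have : v * (1 + t * z) = r * conj u * (1 + t * z) := by rw [← hr]
      rw [this]; ring
    have h3 := h t
    rw [h1] at h3
    have h4 : 0 < r * Complex.normSq u := mul_pos hr0 (Complex.normSq_pos.2 hu)
    rw [Complex.nonneg_iff, Complex.re_ofReal_mul, Complex.im_ofReal_mul] at h3
    rw [Complex.nonneg_iff]
    refine ⟨nonneg_of_mul_nonneg_right h3.1 h4, ?_⟩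
    have := h3.2.symm
    rcases mul_eq_zero.1 this with h5 | h5
    · exact absurd h5 h4.ne'
    · exact h5.symm
  have kre : ∀ t : ℝ, 0 ≤ (w.re * z.re - w.im * z.im) * (t * t) + (w.re + z.re) * t + 1 := by
    intro t
    have := (Complex.nonneg_iff.1 (key t)).1
    simp at this
    nlinarith
  have kim : ∀ t : ℝ, 0 = (w.re * z.im + w.im * z.re) * (t * t) + (w.im + z.im) * t := by
    intro t
    have := (Complex.nonneg_iff.1 (key t)).2
    simp at this
    nlinarith
  have i1 := kim 1
  have i2 := kim (-1)
  have him : z.im = - w.im := by linarith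
  -- The imaginary parts settle everything unless `w` and `z` are real; then the discriminant is
  -- `(z.re - w.re) ^ 2`, so it must vanish.
  have hdisc := discrim_le_zero kre
  rw [discrim] at hdisc
  have hprod : w.im * (z.re - w.re) = 0 := by rw [him] at i1; linarith
  have hre : z.re = w.re := by
    rcases mul_eq_zero.1 hprod with h5 | h5
    · rw [him, h5] at hdisc
      have : (z.re - w.re) ^ 2 ≤ 0 := by nlinarith
      nlinarith [sq_nonneg (z.re - w.re), pow_eq_zero_iff (two_ne_zero) |>.1 (le_antisymm this (sq_nonneg _))]
    · linarith
  have hzw : z = conj w := Complex.ext (by simp [hre]) (by simp [him])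
  have hb : b = v * z := by rw [hz]; field_simp
  have ha : a = u * w := by rw [hw]; field_simp
  rw [hb, ha, hzw, map_mul]
  ring

/-- Nonnegativity of a continuous function extends from a cofinite set to the real line. -/
theorem nonneg_of_finite_exceptions {g : ℝ → ℂ} (hg : Continuous g) {S : Set ℝ} (hS : S.Finite)
    (h : ∀ t ∉ S, 0 ≤ g t) (t : ℝ) : 0 ≤ g t := by
  have hc : IsClosed {t : ℝ | 0 ≤ g t} := isClosed_le continuous_const hg
  have hd : Dense Sᶜ := hS.countable.dense_compl ℝ
  exact hc.closure_subset_iff.2 (fun t ht => h t ht) (hd t)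

/-! ### Diagonal perturbations of determinants and inverses -/

namespace Matrix
variable {ι : Type*} [Fintype ι] [DecidableEq ι] {K : Type*} [Field K]

/-- The perturbation factors through a space of dimension two, so `det (1 + XY) = det (1 + YX)`
reduces it to a 2 × 2 determinant. The case `i = j` is included. -/
theorem det_add_single_add_single (M : Matrix ι ι K) (hM : M.det ≠ 0) (i j : ι) (s t : K) :
    (M + single i i s + single j j t).det =
      M.det * ((1 + s * M⁻¹ i i) * (1 + t * M⁻¹ j j) - s * t * (M⁻¹ i j * M⁻¹ j i)) := by
  have hu : IsUnit M.det := isUnit_iff_ne_zero.2 hM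
  let U : Matrix ι (Fin 2) K := of fun a => ![if a = i then 1 else 0, if a = j then 1 else 0]
  let W : Matrix (Fin 2) ι K := of ![fun a => if a = i then s else 0, fun a => if a = j then t else 0]
  have hUW : single i i s + single j j t = U * W := by
    ext a b
    simp only [add_apply, mul_apply, Fin.sum_univ_two, U, W, of_apply, single_apply]
    simp
    grind
  have h1 : M + single i i s + single j j t = M * (1 + M⁻¹ * U * W) := by
    rw [add_assoc, hUW, mul_add, mul_one, Matrix.mul_assoc, ← Matrix.mul_assoc M, mul_nonsing_inv _ hu,
      Matrix.one_mul]
  rw [h1, det_mul, det_one_add_mul_comm, det_fin_two]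
  congr 1
  simp only [add_apply, one_apply, mul_apply, U, W, of_apply]
  simp [ite_mul, mul_ite]
  ring

theorem det_add_single (M : Matrix ι ι K) (hM : M.det ≠ 0) (i : ι) (t : K) :
    (M + single i i t).det = M.det * (1 + t * M⁻¹ i i) := by
  simpa using det_add_single_add_single M hM i i t 0

/-- Sherman–Morrison with the denominator cleared: the right side is affine in `t`. -/
theorem inv_add_single_apply (M : Matrix ι ι K) (hM : M.det ≠ 0) (k : ι) (t : K)
    (ht : 1 + t * M⁻¹ k k ≠ 0) (i j : ι) :
    (M + single k k t)⁻¹ i j * (1 + t * M⁻¹ k k) =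
      M⁻¹ i j + t * (M⁻¹ k k * M⁻¹ i j - M⁻¹ i k * M⁻¹ k j) := by
  have hu : IsUnit M.det := isUnit_iff_ne_zero.2 hM
  set N := M⁻¹ with hN
  set c : K := (1 + t * N k k)⁻¹ with hc
  have h1 : (M + single k k t)⁻¹ = N - (t * c) • of fun a b => N a k * N k b := by
    apply inv_eq_right_inv
    have h2 : M * (of fun a b => N a k * N k b) = of fun a b => (1 : Matrix ι ι K) a k * N k b := by
      ext a b
      rw [← mul_nonsing_inv M hu]
      simp only [mul_apply, of_apply, Finset.sum_mul, ← hN, mul_assoc]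
    have h3 : single k k t * N = t • of fun a b => (1 : Matrix ι ι K) a k * N k b := by
      ext a b
      simp [mul_apply, single_apply, one_apply, ite_and, eq_comm]
    have h4 : single k k t * (of fun a b => N a k * N k b) =
        (t * N k k) • of fun a b => (1 : Matrix ι ι K) a k * N k b := by
      ext a b
      simp [mul_apply, single_apply, one_apply, ite_and, eq_comm, mul_assoc]
    rw [add_mul, mul_sub, mul_sub, mul_smul_comm, mul_smul_comm, h2, h3, h4, hN, mul_nonsing_inv M hu, ← hN]
    have h5 : t - t * c - t * c * (t * N k k) = 0 := by
      rw [hc]; field_simp; ring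
    rw [smul_smul]
    set R : Matrix ι ι K := of fun a b => (1 : Matrix ι ι K) a k * N k b
    have : (1 : Matrix ι ι K) - (t * c) • R + (t • R - (t * c * (t * N k k)) • R) =
        1 + (t - t * c - t * c * (t * N k k)) • R := by
      simp only [sub_smul]; abel
    rw [this, h5, zero_smul, add_zero]
  rw [h1]
  simp only [sub_apply, smul_apply, of_apply, smul_eq_mul, hc]
  field_simp
  ring

end Matrix

/-! ### Matrices supported on a preorder -/

namespace Matrix
variable {ι : Type*} [Fintype ι] [DecidableEq ι]

/-- The inverse of a matrix whose support is contained in a preorder has support in the preorder. -/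
theorem apply_ne_zero_of_inv_support {K : Type*} [Field K] {M : Matrix ι ι K} (hM : M.det ≠ 0)
    (hrefl : ∀ i, M⁻¹ i i ≠ 0)
    (htrans : ∀ i j k, M⁻¹ i k ≠ 0 → M⁻¹ k j ≠ 0 → M⁻¹ i j ≠ 0) {i j : ι} (h : M i j ≠ 0) :
    M⁻¹ i j ≠ 0 := by
  classical
  intro h0
  have hu : IsUnit M.det := isUnit_iff_ne_zero.2 hM
  have hu' : IsUnit M⁻¹ := by
    rw [isUnit_nonsing_inv_iff]; exact (isUnit_iff_isUnit_det M).2 hu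
  -- The indices `l` with `M⁻¹ l j ≠ 0` form block 0. Transitivity makes `M⁻¹` block triangular,
  -- hence also `M`; here `j` lies in block 0 and `i` in block 1.
  let b : ι → ℕ := fun l => if M⁻¹ l j ≠ 0 then 0 else 1
  have hb : BlockTriangular M⁻¹ b := by
    intro k l hkl
    by_contra hne
    simp only [b] at hkl
    split_ifs at hkl with h1 h2 h3
    all_goals first | omega | skip
    exact h2 (htrans k j l hne h1)
  have : Invertible M⁻¹ := hu'.invertible
  have h2 := blockTriangular_inv_of_blockTriangular hb
  rw [nonsing_inv_nonsing_inv M hu] at h2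
  refine h (h2 ?_)
  simp only [b]
  simp [h0, hrefl j]

/-- The determinant does not change if the entries of a matrix between different classes of a preorder
containing its support are deleted. -/
theorem det_eq_of_support_preorder {R : Type*} [CommRing R] {M M' : Matrix ι ι R} (r : ι → ι → Prop)
    (hrefl : ∀ i, r i i) (htrans : ∀ i j k, r i k → r k j → r i j)
    (hM : ∀ i j, M i j ≠ 0 → r i j)
    (h1 : ∀ i j, r i j → r j i → M' i j = M i j)
    (h2 : ∀ i j, ¬ (r i j ∧ r j i) → M' i j = 0) : M'.det = M.det := by
  rw [det_apply, det_apply]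
  refine Finset.sum_congr rfl fun σ _ => ?_
  congr 1
  by_cases hall : ∀ i, M (σ i) i ≠ 0
  · refine Finset.prod_congr rfl fun i _ => h1 _ _ (hM _ _ (hall i)) ?_
    -- Following the cycle of `σ` all the way round leads back to `i`, so `i` and `σ i` are
    -- equivalent.
    have hpow : ∀ m : ℕ, r ((σ ^ m) (σ i)) (σ i) := by
      intro m
      induction m with
      | zero => exact hrefl _
      | succ m ih =>
        rw [pow_succ', Equiv.Perm.mul_apply]
        exact htrans _ _ _ (hM _ _ (hall _)) ih
    have h3 := hpow (orderOf σ - 1)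
    rwa [← Equiv.Perm.mul_apply, ← pow_succ, Nat.sub_add_cancel (orderOf_pos σ), pow_orderOf_eq_one,
      Equiv.Perm.one_apply] at h3
  · push Not at hall
    obtain ⟨i, hi⟩ := hall
    rw [Finset.prod_eq_zero (f := fun i => M (σ i) i) (Finset.mem_univ i) hi]
    refine Finset.prod_eq_zero (Finset.mem_univ i) ?_
    by_cases h : r (σ i) i ∧ r i (σ i)
    · rw [h1 _ _ h.1 h.2, hi]
    · exact h2 _ _ h

/-- A criterion for an invertible matrix to be diagonally similar to a Hermitian one, up to its entries
between different classes of the preorder given by the support of its inverse. -/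
theorem exists_pos_symmetrizer {M : Matrix ι ι ℂ} (hM : M.det ≠ 0)
    (hpos : ∀ i j, 0 ≤ M⁻¹ i j * M⁻¹ j i)
    (hrefl : ∀ i, M⁻¹ i i ≠ 0)
    (htrans : ∀ i j k, M⁻¹ i k ≠ 0 → M⁻¹ k j ≠ 0 → M⁻¹ i j ≠ 0)
    (hcyc : ∀ i j k, M⁻¹ i j ≠ 0 → M⁻¹ j i ≠ 0 →
      M⁻¹ j k * M⁻¹ k i * conj (M⁻¹ i j) = conj (M⁻¹ i k) * conj (M⁻¹ k j) * M⁻¹ j i) :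
    ∃ d : ι → ℝ, (∀ i, 0 < d i) ∧ ∀ i j, M⁻¹ i j ≠ 0 → M⁻¹ j i ≠ 0 →
      M i j * d j = d i * conj (M j i) := by
  classical
  have hu : IsUnit M.det := isUnit_iff_ne_zero.2 hM
  have hsupp : ∀ i j, M i j ≠ 0 → M⁻¹ i j ≠ 0 := fun i j h =>
    apply_ne_zero_of_inv_support hM hrefl htrans h
  have hMN : M * M⁻¹ = 1 := mul_nonsing_inv M hu
  set N := M⁻¹ with hN
  have hlam : ∀ i j, ∃ l : ℝ, N i j ≠ 0 → N j i ≠ 0 → 0 < l ∧ N j i = l * conj (N i j) := by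
    intro i j
    by_cases h : N i j ≠ 0 ∧ N j i ≠ 0
    · obtain ⟨h1, h2⟩ := h
      have h3 : 0 < N i j * N j i := lt_of_le_of_ne (hpos i j) (mul_ne_zero h1 h2).symm
      obtain ⟨h4, h5⟩ := Complex.pos_iff.1 h3
      refine ⟨(N i j * N j i).re / Complex.normSq (N i j), fun _ _ =>
        ⟨div_pos h4 (Complex.normSq_pos.2 h1), ?_⟩⟩
      have h6 : ((N i j * N j i).re : ℂ) = N i j * N j i := by
        apply Complex.ext <;> simp [← h5]
      have h7 : (Complex.normSq (N i j) : ℂ) = N i j * conj (N i j) := (Complex.mul_conj _).symm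
      have h8 : conj (N i j) ≠ 0 := by simpa using h1
      rw [Complex.ofReal_div, h6, h7]
      field_simp
    · exact ⟨1, fun h1 h2 => absurd ⟨h1, h2⟩ h⟩
  choose l hl using hlam
  let S : Setoid ι :=
    { r := fun i j => N i j ≠ 0 ∧ N j i ≠ 0
      iseqv := ⟨fun i => ⟨hrefl i, hrefl i⟩, fun h => ⟨h.2, h.1⟩, fun h h' =>
        ⟨htrans _ _ _ h.1 h'.1, htrans _ _ _ h'.2 h.2⟩⟩ }
  have hcoc : ∀ i j k, S.r i j → S.r i k → l i j = l i k * l k j := by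
    intro i j k hij hik
    have hkj : S.r k j := S.iseqv.trans (S.iseqv.symm hik) hij
    have h := hcyc i j k hij.1 hij.2
    rw [(hl i j hij.1 hij.2).2, (hl k j hkj.1 hkj.2).2, (hl i k hik.1 hik.2).2] at h
    have h1 : conj (N i j) * conj (N i k) * conj (N k j) ≠ 0 := by
      simpa using ⟨⟨hij.1, hik.1⟩, hkj.1⟩
    have h2 : ((l i j : ℝ) : ℂ) = ((l i k * l k j : ℝ) : ℂ) := by
      apply mul_right_cancel₀ h1
      push_cast
      linear_combination -h
    exact_mod_cast h2
  let rep : ι → ι := fun i => (Quotient.mk S i).out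
  have hrep : ∀ i, S.r (rep i) i := fun i => Quotient.exact (Quotient.out_eq (Quotient.mk S i))
  have hrepeq : ∀ i j, S.r i j → rep i = rep j := fun i j h => by
    simp only [rep]; rw [Quotient.sound h]
  -- The cocycle is trivialized by measuring from a chosen representative of each class.
  let d : ι → ℝ := fun i => l (rep i) i
  have hd : ∀ i, 0 < d i := fun i => (hl _ _ (hrep i).1 (hrep i).2).1
  have hdl : ∀ i j, S.r i j → d j = d i * l i j := by
    intro i j hij
    simp only [d]
    rw [← hrepeq i j hij]
    exact hcoc _ _ _ (S.iseqv.trans (hrep i) hij) (hrep i)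
  refine ⟨d, hd, ?_⟩
  let M' : Matrix ι ι ℂ := of fun i j => if S.r i j then M i j else 0
  let N' : Matrix ι ι ℂ := of fun i j => if S.r i j then N i j else 0
  -- Truncation to classes keeps the two matrices inverse: an index lying between two equivalent
  -- ones belongs to their class.
  have hMN' : M' * N' = 1 := by
    ext i j
    by_cases hij : S.r i j
    · rw [← hMN, mul_apply, mul_apply]
      refine Finset.sum_congr rfl fun k _ => ?_
      simp only [M', N', of_apply]
      by_cases hik : S.r i k
      · rw [if_pos hik, if_pos (S.iseqv.trans (S.iseqv.symm hik) hij)]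
      · rw [if_neg hik, zero_mul]
        by_contra hne
        have h1 : N i k ≠ 0 := hsupp _ _ fun h => hne (by rw [h, zero_mul])
        have h2 : N k j ≠ 0 := fun h => hne (by rw [h, mul_zero])
        exact hik ⟨h1, htrans _ _ _ h2 hij.2⟩
    · have hne : i ≠ j := by rintro rfl; exact hij (S.iseqv.refl i)
      rw [one_apply_ne hne, mul_apply]
      refine Finset.sum_eq_zero fun k _ => ?_
      simp only [M', N', of_apply]
      split_ifs with h1 h2 <;> simp
      exact absurd (S.iseqv.trans h1 h2) hij
  let D : Matrix ι ι ℂ := diagonal fun i => (d i : ℂ)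
  have hND : N' * D = D * N'ᴴ := by
    ext j i
    simp only [D, mul_diagonal, diagonal_mul, conjTranspose_apply, N', of_apply]
    by_cases hij : S.r i j
    · rw [if_pos hij, if_pos (S.iseqv.symm hij), (hl i j hij.1 hij.2).2, hdl i j hij]
      simp; ring
    · rw [if_neg hij, if_neg fun h => hij (S.iseqv.symm h)]; simp
  have hMD : M' * D = D * M'ᴴ := by
    have h1 : N' * M' = 1 := mul_eq_one_comm.1 hMN'
    have h2 : N'ᴴ * M'ᴴ = 1 := by rw [← conjTranspose_mul, hMN', conjTranspose_one]
    calc M' * D = M' * D * (N'ᴴ * M'ᴴ) := by rw [h2, mul_one]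
      _ = M' * (D * N'ᴴ) * M'ᴴ := by simp only [Matrix.mul_assoc]
      _ = (M' * N') * D * M'ᴴ := by rw [← hND]; simp only [Matrix.mul_assoc]
      _ = D * M'ᴴ := by rw [hMN', Matrix.one_mul]
  intro i j h1 h2
  have h3 := congrFun (congrFun hMD i) j
  have hij : S.r i j := ⟨h1, h2⟩
  simp only [D, mul_diagonal, diagonal_mul, conjTranspose_apply, M', of_apply] at h3
  rw [if_pos hij, if_pos (S.iseqv.symm hij)] at h3
  exact h3

end Matrix

/-! ### Evaluation of the pencil -/

variable {n k : ℕ}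

/-- The value of the pencil `diag(x₁, …, xₙ) + ∑ j, A j * x_{n+j} + A₀` at a complex point. -/
noncomputable def pencilAt (A₀ : Matrix (Fin n) (Fin n) ℂ) (A : Fin k → Matrix (Fin n) (Fin n) ℂ)
    (z : Fin n ⊕ Fin k → ℂ) : Matrix (Fin n) (Fin n) ℂ :=
  diagonal (fun i => z (Sum.inl i)) + ∑ j, z (Sum.inr j) • A j + A₀

theorem eval_detPencil_apply (A₀ : Matrix (Fin n) (Fin n) ℂ) (A : Fin k → Matrix (Fin n) (Fin n) ℂ)
    (z : Fin n ⊕ Fin k → ℂ) (i j : Fin n) :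
    MvPolynomial.eval z (detPencil A₀ A i j) = pencilAt A₀ A z i j := by
  simp only [detPencil, pencilAt, Matrix.add_apply, Matrix.sum_apply, Matrix.smul_apply, map_add, map_sum,
    Matrix.map_apply, MvPolynomial.eval_C, smul_eq_mul, map_mul, MvPolynomial.eval_X, diagonal_apply]
  split_ifs <;> simp

theorem map_eval_detPencil (A₀ : Matrix (Fin n) (Fin n) ℂ) (A : Fin k → Matrix (Fin n) (Fin n) ℂ)
    (z : Fin n ⊕ Fin k → ℂ) : (MvPolynomial.eval z).mapMatrix (detPencil A₀ A) = pencilAt A₀ A z := by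
  ext i j
  exact eval_detPencil_apply A₀ A z i j

theorem eval_det_detPencil (A₀ : Matrix (Fin n) (Fin n) ℂ) (A : Fin k → Matrix (Fin n) (Fin n) ℂ)
    (z : Fin n ⊕ Fin k → ℂ) : MvPolynomial.eval z (detPencil A₀ A).det = (pencilAt A₀ A z).det := by
  rw [RingHom.map_det, map_eval_detPencil]

theorem eval_adjugate_detPencil (A₀ : Matrix (Fin n) (Fin n) ℂ) (A : Fin k → Matrix (Fin n) (Fin n) ℂ)
    (z : Fin n ⊕ Fin k → ℂ) (i j : Fin n) :
    MvPolynomial.eval z ((detPencil A₀ A).adjugate i j) = (pencilAt A₀ A z).adjugate i j := by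
  rw [← map_eval_detPencil, ← RingHom.map_adjugate]
  rfl

theorem pencilAt_add_single_inl (A₀ : Matrix (Fin n) (Fin n) ℂ) (A : Fin k → Matrix (Fin n) (Fin n) ℂ)
    (z : Fin n ⊕ Fin k → ℂ) (i : Fin n) (t : ℂ) :
    pencilAt A₀ A (z + Pi.single (Sum.inl i) t) = pencilAt A₀ A z + single i i t := by
  have h : diagonal (fun a => (z + Pi.single (Sum.inl i) t : Fin n ⊕ Fin k → ℂ) (Sum.inl a)) =
      diagonal (fun a => z (Sum.inl a)) + single i i t := by
    ext a b
    simp only [diagonal_apply, Matrix.add_apply, single_apply, Pi.add_apply, Pi.single_apply, Sum.inl.injEq]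
    grind
  simp only [pencilAt, h]
  simp
  abel

theorem pencilAt_add_single_inr (A₀ : Matrix (Fin n) (Fin n) ℂ) (A : Fin k → Matrix (Fin n) (Fin n) ℂ)
    (z : Fin n ⊕ Fin k → ℂ) (l : Fin k) (t : ℂ) :
    pencilAt A₀ A (z + Pi.single (Sum.inr l) t) = pencilAt A₀ A z + t • A l := by
  simp [pencilAt, Pi.single_apply, add_smul, Finset.sum_add_distrib, ite_smul]
  abel

theorem continuous_pencilAt (A₀ : Matrix (Fin n) (Fin n) ℂ) (A : Fin k → Matrix (Fin n) (Fin n) ℂ) :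
    Continuous (pencilAt A₀ A) := by
  unfold pencilAt
  refine ((Continuous.matrix_diagonal (by fun_prop)).add ?_).add continuous_const
  fun_prop

/-- The embedding of real points into complex points. -/
def realPoint {σ : Type*} (p : σ → ℝ) : σ → ℂ := fun i => (p i : ℂ)

theorem realPoint_add_single {σ : Type*} [DecidableEq σ] (p : σ → ℝ) (i : σ) (t : ℝ) :
    realPoint (p + Pi.single i t) = realPoint p + Pi.single i (t : ℂ) := by
  ext a
  by_cases h : a = i
  · subst h; simp [realPoint]
  · simp [realPoint, h]

theorem det_add_single_eq {ι : Type*} [Fintype ι] [DecidableEq ι] (M : Matrix ι ι ℂ) (i : ι) (t : ℂ) :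
    (M + single i i t).det = M.det + t * ((M + single i i 1).det - M.det) := by
  have h : ∀ s : ℂ, M + single i i s = M.updateRow i (M i + s • Pi.single i 1) := by
    intro s
    ext a b
    by_cases ha : a = i
    · subst ha; simp [single_apply, Pi.single_apply, eq_comm]
    · simp [ha, Ne.symm ha]
  rw [h t, h 1, det_updateRow_add, det_updateRow_add, det_updateRow_smul, det_updateRow_smul,
    updateRow_eq_self]
  ring

/-! ### Consequences of stability for the inverse -/

section Stable
variable {A₀ : Matrix (Fin n) (Fin n) ℂ} {A : Fin k → Matrix (Fin n) (Fin n) ℂ}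

/-- Zeros in two of the diagonal variables, the other variables being real, can be moved into the open
upper half-plane. -/
theorem det_pencilAt_ne_zero_of_two (hst : ∀ z, (∀ i, 0 < (z i).im) → (pencilAt A₀ A z).det ≠ 0)
    (p : Fin n ⊕ Fin k → ℝ) (i j : Fin n) (s t : ℂ) (hs : 0 < s.im) (ht : 0 < t.im)
    (hV : (pencilAt A₀ A (realPoint p + Pi.single (Sum.inl i) s + Pi.single (Sum.inl j) 1)).det
      ≠ (pencilAt A₀ A (realPoint p + Pi.single (Sum.inl i) s)).det) :
    (pencilAt A₀ A (realPoint p + Pi.single (Sum.inl i) s + Pi.single (Sum.inl j) t)).det ≠ 0 := by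
  intro h0
  -- All variables are pushed up by `e * I`. The determinant is affine in `x_j` with slope `V`,
  -- nonzero at `e = 0`, so its root `-U / V` moves continuously and stays in the upper half-plane
  -- for small `e`.
  let w : ℝ → Fin n ⊕ Fin k → ℂ := fun e =>
    realPoint p + Pi.single (Sum.inl i) s + fun _ => (e : ℂ) * Complex.I
  have hw : Continuous w := by
    refine continuous_const.add (continuous_pi fun _ => ?_)
    fun_prop
  have hw0 : w 0 = realPoint p + Pi.single (Sum.inl i) s := by ext a; simp [w]
  let U : ℝ → ℂ := fun e => (pencilAt A₀ A (w e)).det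
  let V : ℝ → ℂ := fun e => (pencilAt A₀ A (w e + Pi.single (Sum.inl j) 1)).det - U e
  have hU : Continuous U := ((continuous_pencilAt A₀ A).comp hw).matrix_det
  have hVc : Continuous V :=
    ((continuous_pencilAt A₀ A).comp (hw.add continuous_const)).matrix_det.sub hU
  have hV0 : V 0 ≠ 0 := by
    simp only [V, U, hw0]
    exact sub_ne_zero.2 hV
  have haff : ∀ e τ, (pencilAt A₀ A (w e + Pi.single (Sum.inl j) τ)).det = U e + τ * V e := by
    intro e τ
    simp only [V, U, pencilAt_add_single_inl]
    exact det_add_single_eq _ _ _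
  have ht0 : -U 0 / V 0 = t := by
    have := haff 0 t
    rw [hw0, h0] at this
    rw [div_eq_iff hV0]
    linear_combination this
  have hcont : ContinuousAt (fun e => (-U e / V e).im) 0 :=
    Complex.continuous_im.continuousAt.comp (hU.neg.continuousAt.div hVc.continuousAt hV0)
  have h1 : ∀ᶠ e in nhdsWithin (0 : ℝ) (Set.Ioi 0), 0 < (-U e / V e).im :=
    (hcont.eventually_const_lt (by simpa only [ht0] using ht)).filter_mono nhdsWithin_le_nhds
  have h2 : ∀ᶠ e in nhdsWithin (0 : ℝ) (Set.Ioi 0), V e ≠ 0 :=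
    (hVc.continuousAt.eventually_ne hV0).filter_mono nhdsWithin_le_nhds
  obtain ⟨e, h1, h2, he⟩ := (h1.and (h2.and self_mem_nhdsWithin)).exists
  have he : 0 < e := he
  refine hst (w e + Pi.single (Sum.inl j) (-U e / V e)) ?_ ?_
  · intro a
    have h3 : ∀ (b : Fin n ⊕ Fin k) (x : ℂ), 0 < x.im → 0 ≤ ((Pi.single b x : Fin n ⊕ Fin k → ℂ) a).im := by
      intro b x hx
      by_cases hab : a = b
      · subst hab; simpa using hx.le
      · simp [hab]
    have h4 := h3 (Sum.inl i) s hs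
    have h5 := h3 (Sum.inl j) _ h1
    simp only [w, Pi.add_apply, Complex.add_im, realPoint, Complex.ofReal_im]
    have : ((e : ℂ) * Complex.I).im = e := by simp
    linarith
  · rw [haff, div_mul_cancel₀ _ h2, add_neg_cancel]

/-- Up to the factor `M.det`, the determinant in the two diagonal increments is `(1 + x a)(1 + y b)
- x y c` with `c = N i j * N j i`; real values force real `a`, `b`, `c`, and `c < 0` would produce a
zero in the upper half-plane. -/
theorem inv_mul_inv_nonneg (hst : ∀ z, (∀ i, 0 < (z i).im) → (pencilAt A₀ A z).det ≠ 0)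
    (hreal : ∀ p : Fin n ⊕ Fin k → ℝ, ((pencilAt A₀ A (realPoint p)).det).im = 0)
    (p : Fin n ⊕ Fin k → ℝ) (hp : (pencilAt A₀ A (realPoint p)).det ≠ 0) (i j : Fin n) :
    0 ≤ (pencilAt A₀ A (realPoint p))⁻¹ i j * (pencilAt A₀ A (realPoint p))⁻¹ j i := by
  set M := pencilAt A₀ A (realPoint p) with hM
  have hq : ∀ x y : ℝ, ((M + single i i (x : ℂ) + single j j (y : ℂ)).det / M.det).im = 0 := by
    intro x y
    have h1 := hreal (p + Pi.single (Sum.inl i) x + Pi.single (Sum.inl j) y)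
    have h2 := hreal p
    rw [realPoint_add_single, realPoint_add_single, pencilAt_add_single_inl, pencilAt_add_single_inl] at h1
    rw [← hM] at h1 h2
    simp [Complex.div_im, h1, h2]
  simp only [det_add_single_add_single M hp, mul_div_cancel_left₀ _ hp] at hq
  obtain ⟨a, ha⟩ : ∃ a : ℝ, M⁻¹ i i = a := by
    refine ⟨(M⁻¹ i i).re, ?_⟩
    have := hq 1 0
    apply Complex.ext <;> simp
    simpa using this
  obtain ⟨b, hb⟩ : ∃ b : ℝ, M⁻¹ j j = b := by
    refine ⟨(M⁻¹ j j).re, ?_⟩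
    have := hq 0 1
    apply Complex.ext <;> simp
    simpa using this
  obtain ⟨c, hc⟩ : ∃ c : ℝ, M⁻¹ i j * M⁻¹ j i = c := by
    refine ⟨(M⁻¹ i j * M⁻¹ j i).re, ?_⟩
    have := hq 1 1
    rw [ha, hb] at this
    apply Complex.ext
    · simp
    · simp at this ⊢
      linarith
  rw [hc, Complex.zero_le_real]
  by_contra! hneg
  -- The zero is at `x = -1 / (a + r I)`, `y = -1 / (b + r I)`: there both terms equal `c / ((a + r
  -- I)(b + r I))`, as `(r I) ^ 2 = c`.
  set r := Real.sqrt (-c) with hr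
  have hr0 : 0 < r := Real.sqrt_pos.2 (by linarith)
  have hr2 : (r : ℂ) * r = -c := by
    rw [← Complex.ofReal_mul, Real.mul_self_sqrt (by linarith)]; simp
  have him : ∀ x : ℝ, 0 < (-((x : ℂ) + r * Complex.I)⁻¹).im := by
    intro x
    rw [Complex.neg_im, Complex.inv_im]
    have h1 : 0 < Complex.normSq ((x : ℂ) + r * Complex.I) := by
      rw [Complex.normSq_add_mul_I]; positivity
    have h2 : ((x : ℂ) + r * Complex.I).im = r := by simp
    rw [h2, neg_div, neg_neg]
    positivity
  have hne : ∀ x : ℝ, (x : ℂ) + r * Complex.I ≠ 0 := by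
    intro x h
    have := him x
    rw [h] at this
    simp at this
  have hrI : (r * Complex.I) * (r * Complex.I) = c := by
    linear_combination (-1 : ℂ) * hr2 + (r * r : ℂ) * Complex.I_mul_I
  have hfin := det_pencilAt_ne_zero_of_two hst p i j _ _ (him a) (him b)
  simp only [pencilAt_add_single_inl, ← hM, det_add_single_add_single M hp, det_add_single M hp, ha, hb,
    hc] at hfin
  have hia := hne a
  have hib := hne b
  have hrI0 : (r : ℂ) * Complex.I ≠ 0 := mul_ne_zero (by exact_mod_cast hr0.ne') Complex.I_ne_zero
  rw [← hrI] at hfin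
  generalize (r : ℂ) * Complex.I = ρ at *
  refine hfin ?_ ?_
  · intro h
    have h1 := mul_left_cancel₀ hp h
    field_simp at h1
    apply hib
    apply mul_left_cancel₀ hrI0
    linear_combination h1
  · rw [mul_eq_zero]; right
    field_simp
    ring

end Stable

/-! ### Generic real points -/

theorem exists_eval_realPoint_ne_zero {σ : Type*} [Finite σ] {Q : MvPolynomial σ ℂ} (hQ : Q ≠ 0) :
    ∃ p : σ → ℝ, MvPolynomial.eval (realPoint p) Q ≠ 0 := by
  by_contra! h
  apply hQ
  refine MvPolynomial.funext_set (fun _ => Set.range ((↑) : ℝ → ℂ))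
    (fun _ => Set.infinite_range_of_injective Complex.ofReal_injective) fun z hz => ?_
  have hz' : ∀ i, ∃ x : ℝ, (x : ℂ) = z i := fun i => hz i (Set.mem_univ i)
  choose p hp using hz'
  have : z = realPoint p := funext fun i => (hp i).symm
  rw [this, h p, map_zero]

theorem finite_setOf_eval_line_eq_zero {σ : Type*} [DecidableEq σ] {Q : MvPolynomial σ ℂ} {p : σ → ℝ}
    (hQ : MvPolynomial.eval (realPoint p) Q ≠ 0) (l : σ) :
    {t : ℝ | MvPolynomial.eval (realPoint (p + Pi.single l t)) Q = 0}.Finite := by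
  let q : Polynomial ℂ := MvPolynomial.aeval
    (fun i => Polynomial.C (realPoint p i) + Polynomial.C ((Pi.single l 1 : σ → ℂ) i) * Polynomial.X) Q
  have hq : ∀ t : ℝ, q.eval (t : ℂ) = MvPolynomial.eval (realPoint (p + Pi.single l t)) Q := by
    intro t
    have h1 : q.eval (t : ℂ) = Polynomial.aeval (t : ℂ) q := by simp [Polynomial.aeval_def]
    rw [h1, ← AlgHom.comp_apply, MvPolynomial.comp_aeval, ← MvPolynomial.coe_aeval_eq_eval]
    refine congrArg (fun g => MvPolynomial.aeval g Q) (funext fun i => ?_)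
    rw [realPoint_add_single]
    by_cases h : i = l
    · subst h; simp
    · simp [h]
  have hq0 : q ≠ 0 := by
    intro h
    have := hq 0
    rw [h] at this
    simp at this
    exact hQ this.symm
  refine ((q.rootSet_finite ℂ).preimage (Complex.ofReal_injective.injOn)).subset fun t ht => ?_
  rw [Set.mem_preimage, Polynomial.mem_rootSet]
  exact ⟨hq0, by simpa [Polynomial.aeval_def, hq t] using ht⟩

/-- Put every diagonal variable equal to `s⁻¹` and the others to zero; after rescaling by `s`, the
limit `s → 0` is the adjugate of the identity. -/
theorem adjugate_detPencil_diag_ne_zero (A₀ : Matrix (Fin n) (Fin n) ℂ)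
    (A : Fin k → Matrix (Fin n) (Fin n) ℂ) (i : Fin n) : (detPencil A₀ A).adjugate i i ≠ 0 := by
  intro h
  have h1 : ∀ s : ℂ, s ≠ 0 → (1 + s • A₀).adjugate i i = 0 := by
    intro s hs
    have h2 := eval_adjugate_detPencil A₀ A (Sum.elim (fun _ => s⁻¹) (fun _ => 0)) i i
    rw [h, map_zero] at h2
    have h3 : 1 + s • A₀ = s • pencilAt A₀ A (Sum.elim (fun _ => s⁻¹) (fun _ => 0)) := by
      have : diagonal (fun _ : Fin n => s⁻¹) = s⁻¹ • (1 : Matrix (Fin n) (Fin n) ℂ) := by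
        rw [smul_one_eq_diagonal]
      simp [pencilAt, this, smul_smul, hs]
    rw [h3, adjugate_smul, Matrix.smul_apply, ← h2, smul_zero]
  have hc : Continuous fun s : ℂ => (1 + s • A₀).adjugate i i :=
    Continuous.matrix_elem (Continuous.matrix_adjugate (by fun_prop)) i i
  have h4 : Dense ({0}ᶜ : Set ℂ) := dense_compl_singleton 0
  have h5 := hc.ext_on h4 continuous_const fun s hs => h1 s hs
  have h6 := congrFun h5 0
  simp at h6

/-- `Q` is the product of the determinant and all entries of the adjugate and of the pencil that are
not identically zero. -/
theorem exists_generic_polynomial (A₀ : Matrix (Fin n) (Fin n) ℂ)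
    (A : Fin k → Matrix (Fin n) (Fin n) ℂ) (hdet : (detPencil A₀ A).det ≠ 0) :
    ∃ Q : MvPolynomial (Fin n ⊕ Fin k) ℂ, Q ≠ 0 ∧ ∀ z, MvPolynomial.eval z Q ≠ 0 →
      (pencilAt A₀ A z).det ≠ 0 ∧
      (∀ i j, (detPencil A₀ A).adjugate i j ≠ 0 → (pencilAt A₀ A z)⁻¹ i j ≠ 0) ∧
      ∀ i j, detPencil A₀ A i j ≠ 0 → pencilAt A₀ A z i j ≠ 0 := by
  classical
  refine ⟨(detPencil A₀ A).det *
    (∏ i, ∏ j, if (detPencil A₀ A).adjugate i j = 0 then 1 else (detPencil A₀ A).adjugate i j) *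
    ∏ i, ∏ j, if detPencil A₀ A i j = 0 then 1 else detPencil A₀ A i j, ?_, ?_⟩
  · refine mul_ne_zero (mul_ne_zero hdet ?_) ?_ <;>
    · refine Finset.prod_ne_zero_iff.2 fun i _ => Finset.prod_ne_zero_iff.2 fun j _ => ?_
      split_ifs with h
      · exact one_ne_zero
      · exact h
  · intro z hz
    rw [map_mul, map_mul, map_prod, map_prod] at hz
    simp only [map_prod, mul_ne_zero_iff, Finset.prod_ne_zero_iff, Finset.mem_univ, true_imp_iff] at hz
    obtain ⟨⟨h1, h2⟩, h3⟩ := hz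
    rw [eval_det_detPencil] at h1
    refine ⟨h1, fun i j h => ?_, fun i j h => ?_⟩
    · have := h2 i j
      rw [if_neg h, eval_adjugate_detPencil] at this
      rw [inv_def, Matrix.smul_apply, Ring.inverse_eq_inv', smul_eq_mul]
      exact mul_ne_zero (inv_ne_zero h1) this
    · have := h3 i j
      rwa [if_neg h, eval_detPencil_apply] at this

theorem inv_pencilAt_eq_zero {A₀ : Matrix (Fin n) (Fin n) ℂ} {A : Fin k → Matrix (Fin n) (Fin n) ℂ}
    {i j : Fin n} (h : (detPencil A₀ A).adjugate i j = 0) (z : Fin n ⊕ Fin k → ℂ) :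
    (pencilAt A₀ A z)⁻¹ i j = 0 := by
  rw [inv_def, Matrix.smul_apply, ← eval_adjugate_detPencil, h, map_zero, smul_zero]

/-! ### Cocycle, preorder and the Hermitian pencil -/

section Stable
variable {A₀ : Matrix (Fin n) (Fin n) ℂ} {A : Fin k → Matrix (Fin n) (Fin n) ℂ}

theorem inv_pencilAt_cocycle (hst : ∀ z, (∀ i, 0 < (z i).im) → (pencilAt A₀ A z).det ≠ 0)
    (hreal : ∀ p : Fin n ⊕ Fin k → ℝ, ((pencilAt A₀ A (realPoint p)).det).im = 0)
    {p : Fin n ⊕ Fin k → ℝ} {N : Matrix (Fin n) (Fin n) ℂ}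
    (hp : (pencilAt A₀ A (realPoint p)).det ≠ 0) (hN : (pencilAt A₀ A (realPoint p))⁻¹ = N)
    (i j l : Fin n) (hij : N i j ≠ 0) (hji : N j i ≠ 0) :
    N j l * N l i * conj (N i j) = conj (N i l) * conj (N l j) * N j i := by
  obtain ⟨c, hc⟩ : ∃ c : ℝ, N l l = c := by
    have h1 := inv_mul_inv_nonneg hst hreal p hp l l
    rw [hN] at h1
    obtain ⟨h2, h3⟩ := Complex.nonneg_iff.1 h1
    refine ⟨(N l l).re, Complex.ext (by simp) ?_⟩
    simp at h2 h3 ⊢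
    rcases mul_eq_zero.1 (show (N l l).re * (N l l).im = 0 by linarith) with h | h
    · rw [h] at h2
      nlinarith [sq_nonneg (N l l).im]
    · exact h
  have hfin : {t : ℝ | 1 + (t : ℂ) * N l l = 0}.Finite := by
    refine Set.Subsingleton.finite fun t ht t' ht' => ?_
    simp only [Set.mem_ofPred_eq, hc] at ht ht'
    norm_cast at ht ht'
    have : (t - t') * c = 0 := by linarith
    rcases mul_eq_zero.1 this with h | h
    · linarith
    · rw [h] at ht; simp at ht
  have key := nonneg_of_finite_exceptions
    (g := fun t : ℝ => (N i j + t * (N l l * N i j - N i l * N l j)) *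
      (N j i + t * (N l l * N j i - N j l * N l i))) (by fun_prop) hfin ?_
  -- The terms containing `N l l` cancel because it is real.
  · have h := conj_of_mul_nonneg hij hji key
    simp only [map_sub, map_mul, hc, Complex.conj_ofReal] at h
    linear_combination -h
  · intro t ht
    have ht : 1 + (t : ℂ) * N l l ≠ 0 := ht
    have hdet : (pencilAt A₀ A (realPoint (p + Pi.single (Sum.inl l) t))).det ≠ 0 := by
      rw [realPoint_add_single, pencilAt_add_single_inl, det_add_single _ hp, hN]
      exact mul_ne_zero hp ht
    have h1 := inv_mul_inv_nonneg hst hreal _ hdet i j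
    rw [realPoint_add_single, pencilAt_add_single_inl] at h1
    have h2 := inv_add_single_apply _ hp l t (by rwa [hN]) i j
    have h3 := inv_add_single_apply _ hp l t (by rwa [hN]) j i
    rw [hN] at h2 h3
    rw [← h2, ← h3]
    have h4 : 0 ≤ (1 + (t : ℂ) * N l l) * (1 + (t : ℂ) * N l l) := by
      rw [hc]; norm_cast; exact mul_self_nonneg _
    have := mul_nonneg h1 h4
    convert this using 1
    ring

/-- If the `(i, j)` entry of the inverse vanished identically, Sherman–Morrison in `x_l` would leave
`t * N i l * N l j = 0`. One of `t = 1`, `t = -1` keeps the denominator nonzero. -/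
theorem adjugate_detPencil_trans {p : Fin n ⊕ Fin k → ℝ}
    (hp : (pencilAt A₀ A (realPoint p)).det ≠ 0) {i j l : Fin n}
    (hil : (pencilAt A₀ A (realPoint p))⁻¹ i l ≠ 0) (hlj : (pencilAt A₀ A (realPoint p))⁻¹ l j ≠ 0) :
    (detPencil A₀ A).adjugate i j ≠ 0 := by
  intro h
  have key : ∀ t : ℂ, t ≠ 0 → 1 + t * (pencilAt A₀ A (realPoint p))⁻¹ l l ≠ 0 → False := by
    intro t ht0 ht
    have h1 := inv_add_single_apply _ hp l t ht i j
    rw [← pencilAt_add_single_inl, inv_pencilAt_eq_zero h, inv_pencilAt_eq_zero h] at h1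
    simp at h1
    tauto
  have h1 := not_not.1 (mt (key 1 one_ne_zero) not_false)
  have h2 := not_not.1 (mt (key (-1) (by simp)) not_false)
  have : (2 : ℂ) = 0 := by linear_combination h1 + h2
  norm_num at this

theorem exists_hermitian_pencil (hst : ∀ z, (∀ i, 0 < (z i).im) → (pencilAt A₀ A z).det ≠ 0)
    (hreal : ∀ p : Fin n ⊕ Fin k → ℝ, ((pencilAt A₀ A (realPoint p)).det).im = 0) :
    ∃ (B₀ : Matrix (Fin n) (Fin n) ℂ) (B : Fin k → Matrix (Fin n) (Fin n) ℂ),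
      B₀.IsHermitian ∧ (∀ j, (B j).IsHermitian) ∧
        ∀ z, (pencilAt B₀ B z).det = (pencilAt A₀ A z).det := by
  classical
  have hdet : (detPencil A₀ A).det ≠ 0 := by
    intro h
    refine hst (fun _ => Complex.I) (by simp) ?_
    rw [← eval_det_detPencil, h, map_zero]
  obtain ⟨Q, hQ0, hQ⟩ := exists_generic_polynomial A₀ A hdet
  obtain ⟨p₀, hp₀⟩ := exists_eval_realPoint_ne_zero hQ0
  let r : Fin n → Fin n → Prop := fun i j => (detPencil A₀ A).adjugate i j ≠ 0
  have hr : ∀ p : Fin n ⊕ Fin k → ℝ, MvPolynomial.eval (realPoint p) Q ≠ 0 → ∀ i j,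
      (pencilAt A₀ A (realPoint p))⁻¹ i j ≠ 0 ↔ r i j := fun p hp i j =>
    ⟨fun h h' => h (inv_pencilAt_eq_zero h' _), (hQ _ hp).2.1 i j⟩
  have hrefl : ∀ i, r i i := adjugate_detPencil_diag_ne_zero A₀ A
  have htrans : ∀ i j l, r i l → r l j → r i j := fun i j l h1 h2 =>
    adjugate_detPencil_trans (hQ _ hp₀).1 ((hr _ hp₀ _ _).2 h1) ((hr _ hp₀ _ _).2 h2)
  have hsym : ∀ p : Fin n ⊕ Fin k → ℝ, MvPolynomial.eval (realPoint p) Q ≠ 0 →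
      ∃ d : Fin n → ℝ, (∀ i, 0 < d i) ∧ ∀ i j, r i j → r j i →
        pencilAt A₀ A (realPoint p) i j * d j = d i * conj (pencilAt A₀ A (realPoint p) j i) := by
    intro p hp
    have hp1 := (hQ _ hp).1
    have := exists_pos_symmetrizer hp1 (inv_mul_inv_nonneg hst hreal p hp1)
      (fun i => (hr p hp i i).2 (hrefl i)) ?_ (inv_pencilAt_cocycle hst hreal hp1 rfl)
    · simpa only [hr p hp] using this
    · simpa only [hr p hp] using htrans
  have hsupp : ∀ i j z, pencilAt A₀ A z i j ≠ 0 → r i j := by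
    intro i j z hz
    have h1 : detPencil A₀ A i j ≠ 0 := by
      intro h
      rw [← eval_detPencil_apply, h, map_zero] at hz
      exact hz rfl
    rw [← hr p₀ hp₀]
    refine apply_ne_zero_of_inv_support (hQ _ hp₀).1 ?_ ?_ ((hQ _ hp₀).2.2 i j h1)
    · simpa only [hr p₀ hp₀] using hrefl
    · simpa only [hr p₀ hp₀] using htrans
  obtain ⟨d, hd, hdM⟩ := hsym p₀ hp₀
  have hd' : ∀ i, (d i : ℂ) ≠ 0 := fun i => by exact_mod_cast (hd i).ne'
  have hlin : ∀ l i j, r i j → r j i → A l i j * d j = d i * conj (A l j i) := by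
    intro l i j hij hji
    -- The symmetrizer `e` at each generic point of the line may vary with `t`; only the sign of the
    -- product is retained.
    have hline : ∀ t : ℝ, 0 ≤ (pencilAt A₀ A (realPoint p₀) i j + t * A l i j) *
        (pencilAt A₀ A (realPoint p₀) j i + t * A l j i) := by
      refine nonneg_of_finite_exceptions (by fun_prop)
        (finite_setOf_eval_line_eq_zero hp₀ (Sum.inr l)) fun t ht => ?_
      obtain ⟨e, he, heM⟩ := hsym _ ht
      have h1 := heM i j hij hji
      rw [realPoint_add_single, pencilAt_add_single_inr] at h1
      simp only [Matrix.add_apply, Matrix.smul_apply, smul_eq_mul] at h1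
      generalize pencilAt A₀ A (realPoint p₀) i j + t * A l i j = u at *
      generalize pencilAt A₀ A (realPoint p₀) j i + t * A l j i = v at *
      have he' : (e j : ℂ) ≠ 0 := by exact_mod_cast (he j).ne'
      have h2 : u * v = ((e i / e j * Complex.normSq v : ℝ) : ℂ) := by
        push_cast
        rw [← Complex.mul_conj]
        field_simp
        linear_combination v * h1
      rw [h2, Complex.zero_le_real]
      exact mul_nonneg (div_pos (he i) (he j)).le (Complex.normSq_nonneg v)
    have h0 := hdM i j hij hji
    -- By genericity of `p₀`, an entry vanishing there vanishes identically. This covers the case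
    -- where `conj_of_mul_nonneg` does not apply.
    have hzero : ∀ a b, pencilAt A₀ A (realPoint p₀) a b = 0 → A l a b = 0 := by
      intro a b hab
      have h1 : detPencil A₀ A a b = 0 := by
        by_contra h
        exact (hQ _ hp₀).2.2 a b h hab
      have h2 := eval_detPencil_apply A₀ A (realPoint p₀ + Pi.single (Sum.inr l) 1) a b
      rw [h1, map_zero, pencilAt_add_single_inr] at h2
      simpa [hab] using h2.symm
    by_cases hu : pencilAt A₀ A (realPoint p₀) i j = 0
    · have hv : pencilAt A₀ A (realPoint p₀) j i = 0 := by
        rw [hu] at h0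
        simpa [hd'] using h0.symm
      rw [hzero _ _ hu, hzero _ _ hv]
      simp
    · have hv : pencilAt A₀ A (realPoint p₀) j i ≠ 0 := by
        intro hv
        rw [hv] at h0
        simp [hd', hu] at h0
      have h1 := congrArg conj (conj_of_mul_nonneg hu hv hline)
      simp only [map_mul, Complex.conj_conj] at h1
      apply mul_left_cancel₀ ((map_ne_zero (starRingEnd ℂ)).2 hv)
      linear_combination (-(d j : ℂ)) * h1 + conj (A l j i) * h0
  have hconst : ∀ i j, r i j → r j i → A₀ i j * d j = d i * conj (A₀ j i) := by
    intro i j hij hji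
    have h0 := hdM i j hij hji
    simp only [pencilAt, Matrix.add_apply, Matrix.sum_apply, Matrix.smul_apply, smul_eq_mul, map_add,
      map_sum, map_mul, realPoint, Complex.conj_ofReal, add_mul, mul_add, Finset.sum_mul,
      Finset.mul_sum] at h0
    have h1 : ∀ l, (p₀ (Sum.inr l) : ℂ) * A l i j * d j =
        d i * ((p₀ (Sum.inr l) : ℂ) * conj (A l j i)) := fun l => by
      linear_combination (p₀ (Sum.inr l) : ℂ) * hlin l i j hij hji
    have h2 : (diagonal (fun a => (p₀ (Sum.inl a) : ℂ)) : Matrix (Fin n) (Fin n) ℂ) i j * d j =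
        d i * conj ((diagonal (fun a => (p₀ (Sum.inl a) : ℂ)) : Matrix (Fin n) (Fin n) ℂ) j i) := by
      by_cases h : i = j
      · subst h; simp [mul_comm]
      · simp [h, Ne.symm h]
    rw [h2, Finset.sum_congr rfl fun l _ => h1 l] at h0
    exact add_left_cancel h0
  let s : Fin n → ℝ := fun i => Real.sqrt (d i)
  have hs : ∀ i, (s i : ℂ) ≠ 0 := fun i => by exact_mod_cast (Real.sqrt_pos.2 (hd i)).ne'
  have hss : ∀ i, (s i : ℂ) * s i = d i := fun i => by
    exact_mod_cast Real.mul_self_sqrt (hd i).le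
  -- Truncation to the classes followed by `D^(-1/2) X D^(1/2)`. It is linear and fixes diagonal
  -- matrices, so it carries the pencil to a pencil.
  let T : Matrix (Fin n) (Fin n) ℂ → Matrix (Fin n) (Fin n) ℂ := fun X =>
    of fun i j => if r i j ∧ r j i then (s i : ℂ)⁻¹ * X i j * s j else 0
  have hT : ∀ X : Matrix (Fin n) (Fin n) ℂ,
      (∀ i j, r i j → r j i → X i j * d j = d i * conj (X j i)) → (T X).IsHermitian := by
    intro X hX
    ext i j
    simp only [T, conjTranspose_apply, of_apply]
    by_cases h : r i j ∧ r j i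
    · rw [if_pos h, if_pos h.symm]
      have h1 := hX i j h.1 h.2
      rw [← hss, ← hss] at h1
      have hi := hs i
      have hj := hs j
      simp only [RCLike.star_def, map_mul, map_inv₀, Complex.conj_ofReal]
      field_simp
      linear_combination -h1
    · rw [if_neg h, if_neg fun h' => h h'.symm, star_zero]
  refine ⟨T A₀, fun l => T (A l), hT _ hconst, fun l => hT _ (hlin l), fun z => ?_⟩
  have h1 : pencilAt (T A₀) (fun l => T (A l)) z = T (pencilAt A₀ A z) := by
    ext i j
    simp only [pencilAt, T, Matrix.add_apply, Matrix.sum_apply, Matrix.smul_apply, smul_eq_mul, of_apply]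
    by_cases h : r i j ∧ r j i
    · simp only [if_pos h, mul_add, add_mul, Finset.mul_sum, Finset.sum_mul]
      congr 2
      · by_cases hij : i = j
        · subst hij
          have := hs i
          simp only [diagonal_apply_eq]
          field_simp
        · simp [hij]
      · exact Finset.sum_congr rfl fun l _ => by ring
    · have hij : i ≠ j := by rintro rfl; exact h ⟨hrefl i, hrefl i⟩
      simp [h, hij]
  let M' : Matrix (Fin n) (Fin n) ℂ := of fun i j => if r i j ∧ r j i then pencilAt A₀ A z i j else 0
  have h2 : T (pencilAt A₀ A z) =
      diagonal (fun i => (s i : ℂ)⁻¹) * M' * diagonal (fun i => (s i : ℂ)) := by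
    ext i j
    simp only [T, M', mul_diagonal, diagonal_mul, of_apply]
    split_ifs <;> simp
  have h3 : M'.det = (pencilAt A₀ A z).det := by
    refine det_eq_of_support_preorder r hrefl htrans (fun i j => hsupp i j z) ?_ ?_
    · intro i j h h'
      simp only [M', of_apply, if_pos (And.intro h h')]
    · intro i j h
      simp only [M', of_apply, if_neg h]
  rw [h1, h2, det_mul, det_mul, det_diagonal, det_diagonal, mul_right_comm, ← Finset.prod_mul_distrib, h3]
  simp [hs]

end Stable

theorem theorem6p4 (n k : ℕ) (f : MvPolynomial (Fin n ⊕ Fin k) ℝ)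
    (hstable : RealStable f)
    (hdet : ∃ (A₀ : Matrix (Fin n) (Fin n) ℂ) (A : Fin k → Matrix (Fin n) (Fin n) ℂ),
      MvPolynomial.map (algebraMap ℝ ℂ) f = (detPencil A₀ A).det) :
    ∃ (B₀ : Matrix (Fin n) (Fin n) ℂ) (B : Fin k → Matrix (Fin n) (Fin n) ℂ),
      B₀.IsHermitian ∧ (∀ j, (B j).IsHermitian) ∧
        MvPolynomial.map (algebraMap ℝ ℂ) f = (detPencil B₀ B).det := by
  obtain ⟨A₀, A, hA⟩ := hdet
  have hf : ∀ z, (pencilAt A₀ A z).det = MvPolynomial.aeval z f := fun z => by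
    rw [← eval_det_detPencil, ← hA, MvPolynomial.eval_map, MvPolynomial.aeval_def]
  obtain ⟨B₀, B, h₀, h, hB⟩ := exists_hermitian_pencil (A₀ := A₀) (A := A)
    (fun z hz => by rw [hf]; exact hstable z hz)
    (fun p => by
      have : MvPolynomial.aeval (realPoint p) f = algebraMap ℝ ℂ (MvPolynomial.aeval p f) :=
        MvPolynomial.aeval_algebraMap_apply ℂ p f
      rw [hf, this]
      simp)
  refine ⟨B₀, B, h₀, h, MvPolynomial.funext fun z => ?_⟩
  rw [hA, eval_det_detPencil, eval_det_detPencil, hB]
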